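/- For sets $A,B\subseteq\mathbb N$ write $A\le_e B$ (enumeration reducibility) if there is a c.e. set $\Gamma$ with $A=\Gamma(B):=\{n : \exists u\,(\langle n,u\rangle\in\Gamma \text{ and } D_u\subseteq B)\}$, where $D_u$ is the finite set with canonical index $u$; let $\Gamma_i$ be the operator given by the $i$-th c.e. set, and write $A\equiv_e B$ if $A\le_e B$ and $B\le_e A$. We say $A\equiv_e B$ via $\langle i,j\rangle$ if $A=\Gamma_i(B)$ and $B=\Gamma_j(A)$. Let $f,g\colon\mathcal P(\mathbb N)\to\mathcal P(\mathbb N)$. The function $f$ is *$e$-invariant* if $A\equiv_e B$ implies $f(A)\equiv_e f(B)$; it is *uniformly $e$-invariant* if it is $e$-invariant and there is $u\colon\mathbb N\to\mathbb N$ such that, whenever $A\equiv_e B$ via $p$, $f(A)\equiv_e f(B)$ via $u(p)$. Write $f\le_e^{\triangledown}g$ if there is $C\subseteq\mathbb N$ such that $f(X)\le_e g(X)$ for all $X\ge_e C$, and $f\equiv_e^{\triangledown}g$ if $f\le_e^{\triangledown}g$ and $g\le_e^{\triangledown}f$. Call $f$ *nonconstant* if it is not constant on a cone, i.e. if there is no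 $C\subseteq\mathbb N$ such that $f(X)\equiv_e f(Y)$ for all $X,Y\ge_e C$. Then: 1. Enumeration reducibility on $\mathcal P(\mathbb N)$ embeds as a preorder into the set of Borel nonconstant $e$-invariant functions preordered by $\le_e^{\triangledown}$: there is an injective map $A\mapsto f_A$ from $\mathcal P(\mathbb N)$ to this set such that, for all $A,B\subseteq\mathbb N$, $A\le_e B$ if and only if $f_A\le_e^{\triangledown}f_B$. 2. Turing reducibility on $\mathcal P(\mathbb N)$ embeds into the same preorder: there is an injective map $A\mapsto h_A$ from $\mathcal P(\mathbb N)$ to the same set such that, for all $A,B\subseteq\mathbb N$, $A\le_T B$ if and only if $h_A\le_e^{\triangledown}h_B$. 3. The preorder $\le_e^{\triangledown}$ is not locally countable, even on the Borel nonconstant uniformly $e$-invariant functions: there are a Borel nonconstant uniformly $e$-invariant function $f$ and an uncountable set $\mathcal G$ of such functions, pairwise not $\equiv_e^{\triangledown}$-equivalent, with $g\le_e^{\triangledown}f$ for every $g\in\mathcal G$. -/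

import Mathlib

namespace EnumDeg

/-- The finite set `D_u` with canonical index `u`: `k ∈ D_u` iff the `k`-th binary digit of `u`
is `1`, that is, `u = ∑ k ∈ D_u, 2 ^ k`. -/
def canonicalFinite (u : ℕ) : Set ℕ := {k | u.testBit k = true}

/-- The set obtained by applying `Γ`, read as a list of axioms `⟨n, u⟩`
("if `D_u ⊆ B`, enumerate `n`"), to the set `B`. It is used with c.e. sets `Γ` only. -/
def enumOp (Γ B : Set ℕ) : Set ℕ :=
  {n | ∃ u : ℕ, Nat.pair n u ∈ Γ ∧ canonicalFinite u ⊆ B}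

/-- Enumeration reducibility `A ≤ₑ B`: `A = Γ(B)` for some c.e. set `Γ`. -/
def EReducible (A B : Set ℕ) : Prop :=
  ∃ Γ : Set ℕ, REPred (fun m => m ∈ Γ) ∧ A = enumOp Γ B

/-- Enumeration equivalence `A ≡ₑ B`. -/
def EEquiv (A B : Set ℕ) : Prop := EReducible A B ∧ EReducible B A

/-- The `i`-th c.e. set: the domain of the `i`-th partial computable function. -/
def ceSet (i : ℕ) : Set ℕ := {m | ((Nat.Partrec.Code.ofNatCode i).eval m).Dom}

/-- `A ≡ₑ B` via `p = ⟨i, j⟩`: `A = Γ_i(B)` and `B = Γ_j(A)`. -/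
def EEquivVia (p : ℕ) (A B : Set ℕ) : Prop :=
  A = enumOp (ceSet p.unpair.1) B ∧ B = enumOp (ceSet p.unpair.2) A

/-- `f` is `e`-invariant: it maps `e`-equivalent sets to `e`-equivalent sets. -/
def EInvariant (f : Set ℕ → Set ℕ) : Prop :=
  ∀ A B : Set ℕ, EEquiv A B → EEquiv (f A) (f B)

/-- `f` is uniformly `e`-invariant: it is `e`-invariant and has a uniformity function `u`. -/
def UniformlyEInvariant (f : Set ℕ → Set ℕ) : Prop :=
  EInvariant f ∧
    ∃ u : ℕ → ℕ, ∀ (p : ℕ) (A B : Set ℕ), EEquivVia p A B → EEquivVia (u p) (f A) (f B)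

/-- `f ≤ₑ g` on a cone of enumeration degrees. -/
def LEOnCone (f g : Set ℕ → Set ℕ) : Prop :=
  ∃ C : Set ℕ, ∀ X : Set ℕ, EReducible C X → EReducible (f X) (g X)

/-- `f` is constant, up to `≡ₑ`, on some cone of enumeration degrees. -/
def ConstantOnCone (f : Set ℕ → Set ℕ) : Prop :=
  ∃ C : Set ℕ, ∀ X Y : Set ℕ, EReducible C X → EReducible C Y → EEquiv (f X) (f Y)

/-- The Borel `e`-invariant functions that are not constant on any cone. The `σ`-algebra on `Set ℕ`
is the product `σ`-algebra of `{0, 1} ^ ℕ`, which is the Borel `σ`-algebra of Cantor space. -/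
def BorelInvariantNonconstant (f : Set ℕ → Set ℕ) : Prop :=
  Measurable f ∧ EInvariant f ∧ ¬ ConstantOnCone f

/-- The Borel uniformly `e`-invariant functions that are not constant on any cone. -/
def BorelUniformNonconstant (f : Set ℕ → Set ℕ) : Prop :=
  Measurable f ∧ UniformlyEInvariant f ∧ ¬ ConstantOnCone f

open Classical in
/-- The characteristic function of a set, as an (everywhere defined) partial function. -/
noncomputable def charFun (A : Set ℕ) : ℕ →. ℕ :=
  fun n => Part.some (if n ∈ A then 1 else 0)

/-- Turing reducibility of sets of natural numbers. -/
def TReducible (A B : Set ℕ) : Prop := TuringReducible (charFun A) (charFun B)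

end EnumDeg

/-!
The values of the functions used here depend on whether the enumeration degree of the argument is
total, that is, contains a set of the form `Y ⊕ Yᶜ`. The function `constOnNontotal A` sends every
set of nontotal degree to (a code of) `A` and every set `X` of total degree to (a code of) `X`.

Both kinds of degree are cofinal. The total ones because `C ≤ₑ C ⊕ Cᶜ`; as only countably many sets
reduce to a given one, every cone contains inequivalent total degrees, so `constOnNontotal A` is
constant on no cone. For nontotal degrees (`exists_eReducible_not_hasTotalDegree`), the point is
that enumeration operators are monotone while two different sets of the form `Y ⊕ Yᶜ` are
incomparable under inclusion: the sets whose degree is total via two given operators form an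
antichain, so an uncountable chain of sets above `C`, built from Dedekind cuts, has a member of
nontotal degree. Hence `constOnNontotal A` is below `constOnNontotal B` on a cone if and only if
`A ≤ₑ B` (`lEOnCone_constOnNontotal_iff`), which gives the embedding of enumeration reducibility.
Composing with `A ↦ A ⊕ Aᶜ` gives the embedding of Turing reducibility, because `A ≤_T B` if and
only if `A ⊕ Aᶜ ≤ₑ B ⊕ Bᶜ` (`tReducible_iff_eReducible_totalize`).

The code of a value carries a flag for the total case, so one enumeration operator handles both
cases and `constOnNontotal A` is uniformly `e`-invariant. Each `constOnNontotal A` is below the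
identity on the cone above `A`, and there are uncountably many enumeration degrees, so the identity
bounds uncountably many inequivalent functions. Totality of the degree is an arithmetical property,
which makes all these functions Borel.

Enumerability is handled through `EnumerableFrom`, a form of relative enumerability that is uniform
in a family of oracles and closed under the positive connectives, existential quantifiers, bounded
universal quantifiers and substitution.
-/

namespace EnumDeg

/-! ### Uniform enumerability -/

section EnumerableFrom

variable {ι α β : Type*} [Primcodable α] [Primcodable β]

/-- `P i a` is enumerable from positive information about the oracle `O i`, uniformly in `i`: one
primitive recursive matrix `R (a, s, u)` certifies `P i a` by finding a finite set `D_u ⊆ O i`.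
The extra search variable `s` makes a primitive recursive matrix as strong as a c.e. one. A family
over `Unit` expresses reducibility to a single set. -/
def EnumerableFrom (O : ι → Set ℕ) (P : ι → α → Prop) : Prop :=
  ∃ R : α × ℕ × ℕ → Prop, PrimrecPred R ∧
    ∀ i a, P i a ↔ ∃ s u, R (a, s, u) ∧ canonicalFinite u ⊆ O i

theorem primrecRel_testBit : PrimrecRel fun u k : ℕ => u.testBit k = true := by
  have hp : Primrec fun p : ℕ × ℕ => 2 ^ p.2 :=
    (Primrec₂.unpaired'.1 Nat.Primrec.pow).comp (Primrec.const 2) Primrec.snd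
  have h : PrimrecPred fun p : ℕ × ℕ => p.1 / 2 ^ p.2 % 2 = 1 :=
    Primrec.eq.comp
      (Primrec.nat_mod.comp (Primrec.nat_div.comp Primrec.fst hp) (Primrec.const 2))
      (Primrec.const 1)
  refine PrimrecPred.of_eq h fun p => ?_
  simp [Nat.testBit_eq_decide_div_mod_eq]

theorem lt_of_mem_canonicalFinite {u k : ℕ} (h : k ∈ canonicalFinite u) : k < u :=
  Nat.lt_of_lt_of_le Nat.lt_two_pow_self (Nat.ge_two_pow_of_testBit h)

theorem primrecRel_canonicalFinite_subset :
    PrimrecRel fun v u : ℕ => canonicalFinite v ⊆ canonicalFinite u := by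
  have h : PrimrecRel fun (k : ℕ) (p : ℕ × ℕ) => ¬ p.1.testBit k = true ∨ p.2.testBit k = true :=
    PrimrecPred.or
      (primrecRel_testBit.comp (Primrec.fst.comp Primrec.snd) Primrec.fst).not
      (primrecRel_testBit.comp (Primrec.snd.comp Primrec.snd) Primrec.fst)
  refine PrimrecPred.of_eq
    (h.forall_mem_list.comp (Primrec.list_range.comp Primrec.fst) Primrec.id) fun p => ?_
  simp only [List.mem_range, id]
  constructor
  · intro H k hk
    exact (H k (lt_of_mem_canonicalFinite hk)).resolve_left (fun h => h hk)
  · intro H k _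
    by_cases hk : p.1.testBit k = true
    · exact .inr (H hk)
    · exact .inl hk

theorem exists_canonicalFinite_eq (s : Finset ℕ) : ∃ u, canonicalFinite u = s := by
  refine ⟨Finset.equivBitIndices.symm s, Set.ext fun k => ?_⟩
  have h := congrArg (k ∈ ·) (Finset.equivBitIndices.apply_symm_apply s)
  simp only [Finset.equivBitIndices_apply, List.mem_toFinset, Nat.mem_bitIndices] at h
  exact h.to_iff

theorem canonicalFinite_finite (u : ℕ) : (canonicalFinite u).Finite :=
  (Set.finite_lt_nat u).subset fun _ h => lt_of_mem_canonicalFinite h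

namespace EnumerableFrom

variable {O : ι → Set ℕ} {P Q : ι → α → Prop}

theorem of_iff (h : EnumerableFrom O P) (H : ∀ i a, Q i a ↔ P i a) : EnumerableFrom O Q := by
  obtain ⟨R, hR, h⟩ := h
  exact ⟨R, hR, fun i a => (H i a).trans (h i a)⟩

theorem of_primrecPred {p : α → Prop} (h : PrimrecPred p) :
    EnumerableFrom O fun _ a => p a := by
  refine ⟨fun x => p x.1, h.comp Primrec.fst, fun i a => ⟨fun H => ⟨0, 0, H, ?_⟩, ?_⟩⟩
  · intro k hk
    simp [canonicalFinite] at hk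
  · rintro ⟨_, _, H, _⟩
    exact H

theorem comp {P : ι → β → Prop} (h : EnumerableFrom O P) {f : α → β} (hf : Primrec f) :
    EnumerableFrom O fun i a => P i (f a) := by
  obtain ⟨R, hR, h⟩ := h
  exact ⟨fun x => R (f x.1, x.2), hR.comp ((hf.comp Primrec.fst).pair Primrec.snd),
    fun i a => h i (f a)⟩

theorem mem_oracle : EnumerableFrom O fun i n => n ∈ O i := by
  refine ⟨fun x => x.2.2.testBit x.1 = true,
    primrecRel_testBit.comp (Primrec.snd.comp Primrec.snd) Primrec.fst,
    fun i n => ⟨fun h => ?_, fun ⟨_, _, h, hu⟩ => hu h⟩⟩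
  obtain ⟨u, hu⟩ := exists_canonicalFinite_eq {n}
  have hn : n ∈ canonicalFinite u := by simp [hu]
  exact ⟨0, u, hn, by simpa [hu] using h⟩

theorem or (hP : EnumerableFrom O P) (hQ : EnumerableFrom O Q) :
    EnumerableFrom O fun i a => P i a ∨ Q i a := by
  obtain ⟨R, hR, hP⟩ := hP
  obtain ⟨S, hS, hQ⟩ := hQ
  refine ⟨fun x => R x ∨ S x, hR.or hS, fun i a => ?_⟩
  change P i a ∨ Q i a ↔ _
  rw [hP, hQ]
  simp only [or_and_right, exists_or]

/-- The matrix can be taken increasing in the search bound and in the finite set, so that finitely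
many searches can share one bound and one finite set. -/
theorem exists_monotone (h : EnumerableFrom O P) :
    ∃ R : α × ℕ × ℕ → Prop, PrimrecPred R ∧
      (∀ a s t u v, s ≤ t → canonicalFinite u ⊆ canonicalFinite v → R (a, s, u) → R (a, t, v)) ∧
      ∀ i a, P i a ↔ ∃ s u, R (a, s, u) ∧ canonicalFinite u ⊆ O i := by
  obtain ⟨R, hR, h⟩ := h
  refine ⟨fun x => ∃ s ∈ List.range x.2.1, ∃ u ∈ List.range x.2.1,
    R (x.1, s, u) ∧ canonicalFinite u ⊆ canonicalFinite x.2.2, ?_, ?_, ?_⟩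
  · have h1 : PrimrecRel fun (u : ℕ) (y : ℕ × α × ℕ × ℕ) =>
        R (y.2.1, y.1, u) ∧ canonicalFinite u ⊆ canonicalFinite y.2.2.2 := by
      refine PrimrecPred.and (hR.comp (f := fun p : ℕ × ℕ × α × ℕ × ℕ => (p.2.2.1, p.2.1, p.1)) ?_)
        (primrecRel_canonicalFinite_subset.comp Primrec.fst ?_)
      · exact (Primrec.fst.comp (Primrec.snd.comp Primrec.snd)).pair
          ((Primrec.fst.comp Primrec.snd).pair Primrec.fst)
      · exact Primrec.snd.comp (Primrec.snd.comp (Primrec.snd.comp Primrec.snd))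
    have hr : Primrec fun p : ℕ × α × ℕ × ℕ => List.range p.2.2.1 :=
      Primrec.list_range.comp (Primrec.fst.comp (Primrec.snd.comp Primrec.snd))
    have h2 : PrimrecRel fun (s : ℕ) (x : α × ℕ × ℕ) => ∃ u ∈ List.range x.2.1,
        R (x.1, s, u) ∧ canonicalFinite u ⊆ canonicalFinite x.2.2 :=
      h1.exists_mem_list.comp hr Primrec.id
    exact h2.exists_mem_list.comp
      (Primrec.list_range.comp (Primrec.fst.comp Primrec.snd)) Primrec.id
  · rintro a s t u v hst huv ⟨s', hs', u', hu', hR', hD⟩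
    simp only [List.mem_range] at *
    exact ⟨s', hs'.trans_le hst, u', hu'.trans_le hst, hR', hD.trans huv⟩
  · intro i a
    rw [h]
    constructor
    · rintro ⟨s, u, hR', hu⟩
      exact ⟨s + u + 1, u, ⟨s, by simp, u, by simp, hR', subset_rfl⟩, hu⟩
    · rintro ⟨_, u, ⟨s, _, v, _, hR', hv⟩, hu⟩
      exact ⟨s, v, hR', hv.trans hu⟩

theorem and (hP : EnumerableFrom O P) (hQ : EnumerableFrom O Q) :
    EnumerableFrom O fun i a => P i a ∧ Q i a := by
  obtain ⟨R, hR, hRm, hP⟩ := hP.exists_monotone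
  obtain ⟨S, hS, hSm, hQ⟩ := hQ.exists_monotone
  refine ⟨fun x => R x ∧ S x, hR.and hS, fun i a => ?_⟩
  change P i a ∧ Q i a ↔ _
  rw [hP, hQ]
  constructor
  · rintro ⟨⟨s, u, h1, hu⟩, t, v, h2, hv⟩
    obtain ⟨w, hw⟩ := exists_canonicalFinite_eq
      ((canonicalFinite_finite u).union (canonicalFinite_finite v)).toFinset
    rw [Set.Finite.coe_toFinset] at hw
    exact ⟨max s t, w,
      ⟨hRm a s _ u w (le_max_left _ _) (hw ▸ Set.subset_union_left) h1,
        hSm a t _ v w (le_max_right _ _) (hw ▸ Set.subset_union_right) h2⟩,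
      hw ▸ Set.union_subset hu hv⟩
  · rintro ⟨s, u, ⟨h1, h2⟩, hu⟩
    exact ⟨⟨s, u, h1, hu⟩, s, u, h2, hu⟩

theorem exists_nat {P : ι → α × ℕ → Prop} (h : EnumerableFrom O P) :
    EnumerableFrom O fun i a => ∃ n, P i (a, n) := by
  obtain ⟨R, hR, h⟩ := h
  refine ⟨fun x => R ((x.1, x.2.1.unpair.1), x.2.1.unpair.2, x.2.2), hR.comp ?_, fun i a => ?_⟩
  · have hu : Primrec fun x : α × ℕ × ℕ => x.2.1.unpair :=
      Primrec.unpair.comp (Primrec.fst.comp Primrec.snd)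
    exact (Primrec.fst.pair (Primrec.fst.comp hu)).pair
      ((Primrec.snd.comp hu).pair (Primrec.snd.comp Primrec.snd))
  · simp only [h]
    constructor
    · rintro ⟨n, s, u, hR', hu⟩
      exact ⟨Nat.pair n s, u, by simpa using hR', hu⟩
    · rintro ⟨s, u, hR', hu⟩
      exact ⟨_, _, _, hR', hu⟩

theorem exists_denumerable {γ : Type*} [Denumerable γ] {P : ι → α × γ → Prop}
    (h : EnumerableFrom O P) : EnumerableFrom O fun i a => ∃ c, P i (a, c) := by
  have h' : EnumerableFrom O fun i (x : α × ℕ) => P i (x.1, Denumerable.ofNat γ x.2) :=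
    h.comp (Primrec.fst.pair ((Primrec.ofNat γ).comp Primrec.snd))
  refine h'.exists_nat.of_iff fun i a => ?_
  exact ⟨fun ⟨c, hc⟩ => ⟨Encodable.encode c, by simpa using hc⟩, fun ⟨n, hn⟩ => ⟨_, hn⟩⟩

theorem forall_lt {P : ι → α × ℕ → Prop} (h : EnumerableFrom O P) :
    EnumerableFrom O fun i (x : α × ℕ) => ∀ k < x.2, P i (x.1, k) := by
  obtain ⟨R, hR, hRm, h⟩ := h.exists_monotone
  refine ⟨fun x => ∀ k ∈ List.range x.1.2, R ((x.1.1, k), x.2), ?_, fun i x => ?_⟩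
  · have h1 : PrimrecRel fun (k : ℕ) (x : (α × ℕ) × ℕ × ℕ) => R ((x.1.1, k), x.2) :=
      hR.comp (((Primrec.fst.comp (Primrec.fst.comp Primrec.snd)).pair Primrec.fst).pair
        (Primrec.snd.comp Primrec.snd))
    exact h1.forall_mem_list.comp
      (Primrec.list_range.comp (Primrec.snd.comp Primrec.fst)) Primrec.id
  · obtain ⟨a, n⟩ := x
    simp only [List.mem_range, h]
    constructor
    · intro H
      induction n with
      | zero => exact ⟨0, 0, by simp, by intro k hk; simp [canonicalFinite] at hk⟩
      | succ n ih =>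
        obtain ⟨s, u, h1, hu⟩ := ih fun k hk => H k (by omega)
        obtain ⟨t, v, h2, hv⟩ := H n (by omega)
        obtain ⟨w, hw⟩ := exists_canonicalFinite_eq
          ((canonicalFinite_finite u).union (canonicalFinite_finite v)).toFinset
        rw [Set.Finite.coe_toFinset] at hw
        refine ⟨max s t, w, fun k hk => ?_, hw ▸ Set.union_subset hu hv⟩
        rcases Nat.lt_succ_iff_lt_or_eq.1 hk with hk | rfl
        · exact hRm _ s _ u w (le_max_left _ _) (hw ▸ Set.subset_union_left) (h1 k hk)
        · exact hRm _ t _ v w (le_max_right _ _) (hw ▸ Set.subset_union_right) h2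
    · rintro ⟨s, u, H, hu⟩ k hk
      exact ⟨s, u, H k hk, hu⟩

/-- Relative enumerability is transitive, uniformly. -/
theorem subst {O' : ι → Set ℕ} (h : EnumerableFrom O P)
    (hO : EnumerableFrom O' fun i n => n ∈ O i) : EnumerableFrom O' P := by
  obtain ⟨R, hR, h⟩ := h
  have hsub : EnumerableFrom O' fun i (u : ℕ) => canonicalFinite u ⊆ O i := by
    have h1 : EnumerableFrom O' fun i (x : ℕ × ℕ) => ¬ x.1.testBit x.2 = true ∨ x.2 ∈ O i :=
      (of_primrecPred primrecRel_testBit.not).or (hO.comp Primrec.snd)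
    refine (h1.forall_lt.comp (Primrec.id.pair Primrec.id)).of_iff fun i u => ⟨?_, ?_⟩
    · intro H k _
      by_cases hk : u.testBit k = true
      · exact .inr (H hk)
      · exact .inl hk
    · intro H k hk
      exact (H k (lt_of_mem_canonicalFinite hk)).resolve_left (fun h => h hk)
  have h2 : EnumerableFrom O' fun i (x : (α × ℕ) × ℕ) =>
      R (x.1.1, x.1.2, x.2) ∧ canonicalFinite x.2 ⊆ O i :=
    (of_primrecPred (hR.comp ((Primrec.fst.comp Primrec.fst).pair
      ((Primrec.snd.comp Primrec.fst).pair Primrec.snd)))).and (hsub.comp Primrec.snd)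
  exact h2.exists_nat.exists_nat.of_iff h

end EnumerableFrom

/-! ### Enumeration operators given by indices -/

theorem exists_primrecPred_mem_ceSet (e : ℕ) :
    ∃ R : ℕ × ℕ → Prop, PrimrecPred R ∧ ∀ m, m ∈ ceSet e ↔ ∃ s, R (m, s) := by
  set c : Nat.Partrec.Code := Nat.Partrec.Code.ofNatCode e with hc
  refine ⟨fun x => (Nat.Partrec.Code.evaln x.2 c x.1).isSome = true, ?_, fun m => ?_⟩
  · exact Primrec.eq.comp (Primrec.option_isSome.comp (Nat.Partrec.Code.primrec_evaln.comp
      ((Primrec.snd.pair (Primrec.const c)).pair Primrec.fst))) (Primrec.const true)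
  · simp only [ceSet, Set.mem_ofPred_eq, Part.dom_iff_mem, Nat.Partrec.Code.evaln_complete,
      Option.isSome_iff_exists, ← hc]
    exact exists_comm

theorem exists_ceSet_eq {p : ℕ → Prop} (h : REPred p) : ∃ e, ceSet e = {n | p n} := by
  have h1 : Partrec fun n => (Part.assert (p n) fun _ => Part.some ()).map fun _ => (0 : ℕ) :=
    Partrec.map h (Computable.const 0).to₂
  obtain ⟨c, hc⟩ := Nat.Partrec.Code.exists_code.1 (Partrec.nat_iff.1 h1)
  refine ⟨Encodable.encode c, Set.ext fun n => ?_⟩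
  have : Nat.Partrec.Code.ofNatCode (Encodable.encode c) = c := Denumerable.ofNat_encode c
  simp only [ceSet, this, hc, Set.mem_ofPred_eq, Part.map_Dom]
  exact exists_prop.trans (and_iff_left trivial)

theorem rePred_mem_ceSet (e : ℕ) : REPred fun m => m ∈ ceSet e :=
  Partrec.dom_re (Partrec.nat_iff.2 (Nat.Partrec.Code.exists_code.2 ⟨_, rfl⟩))

theorem eReducible_iff_exists_ceSet {A B : Set ℕ} :
    EReducible A B ↔ ∃ e, A = enumOp (ceSet e) B := by
  constructor
  · rintro ⟨Γ, hΓ, rfl⟩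
    obtain ⟨e, he⟩ := exists_ceSet_eq hΓ
    exact ⟨e, by rw [he]; rfl⟩
  · rintro ⟨e, rfl⟩
    exact ⟨_, rePred_mem_ceSet e, rfl⟩

theorem rePred_exists {R : α × ℕ → Prop} (hR : PrimrecPred R) :
    REPred fun a => ∃ s, R (a, s) := by
  classical
  have h : Partrec fun a => Nat.rfind fun s => Part.some (decide (R (a, s))) :=
    Partrec.rfind hR.decide.to_comp.partrec
  refine h.dom_re.of_eq fun a => ?_
  rw [Part.dom_iff_mem]
  constructor
  · rintro ⟨s, hs⟩
    exact ⟨s, by simpa using Nat.rfind_spec hs⟩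
  · rintro ⟨s, hs⟩
    obtain ⟨t, ht, _⟩ := Nat.rfind_min' (p := fun s => decide (R (a, s))) (by simpa using hs)
    exact ⟨t, ht⟩

theorem EnumerableFrom.exists_ceSet {O : ι → Set ℕ} {P : ι → ℕ → Prop}
    (h : EnumerableFrom O P) : ∃ e, ∀ i, {n | P i n} = enumOp (ceSet e) (O i) := by
  obtain ⟨R, hR, h⟩ := h
  have h1 : REPred fun m : ℕ => ∃ s, R (m.unpair.1, s, m.unpair.2) := by
    refine rePred_exists (R := fun x : ℕ × ℕ => R (x.1.unpair.1, x.2, x.1.unpair.2)) (hR.comp ?_)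
    have hu : Primrec fun x : ℕ × ℕ => x.1.unpair := Primrec.unpair.comp Primrec.fst
    exact (Primrec.fst.comp hu).pair (Primrec.snd.pair (Primrec.snd.comp hu))
  obtain ⟨e, he⟩ := exists_ceSet_eq h1
  refine ⟨e, fun i => Set.ext fun n => ?_⟩
  simp only [Set.mem_ofPred_eq, h, enumOp, he, Nat.unpair_pair]
  constructor
  · rintro ⟨s, u, h1, h2⟩
    exact ⟨u, ⟨s, h1⟩, h2⟩
  · rintro ⟨u, ⟨s, h1⟩, h2⟩
    exact ⟨s, u, h1, h2⟩

theorem enumerableFrom_enumOp_ceSet (O : ι → Set ℕ) (e : ℕ) :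
    EnumerableFrom O fun i n => n ∈ enumOp (ceSet e) (O i) := by
  obtain ⟨R, hR, h⟩ := exists_primrecPred_mem_ceSet e
  refine ⟨fun x => R (Nat.pair x.1 x.2.2, x.2.1), hR.comp ?_, fun i n => ?_⟩
  · exact (Primrec₂.natPair.comp Primrec.fst (Primrec.snd.comp Primrec.snd)).pair
      (Primrec.fst.comp Primrec.snd)
  · simp only [enumOp, Set.mem_ofPred_eq, h]
    constructor
    · rintro ⟨u, ⟨s, h1⟩, h2⟩
      exact ⟨s, u, h1, h2⟩
    · rintro ⟨s, u, h1, h2⟩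
      exact ⟨u, ⟨s, h1⟩, h2⟩

theorem eReducible_iff_enumerableFrom {A B : Set ℕ} :
    EReducible A B ↔ EnumerableFrom (fun _ : Unit => B) fun _ n => n ∈ A := by
  rw [eReducible_iff_exists_ceSet]
  constructor
  · rintro ⟨e, rfl⟩
    exact enumerableFrom_enumOp_ceSet _ e
  · intro h
    obtain ⟨e, he⟩ := h.exists_ceSet
    exact ⟨e, he ()⟩

end EnumerableFrom

theorem EReducible.refl (A : Set ℕ) : EReducible A A :=
  eReducible_iff_enumerableFrom.2 EnumerableFrom.mem_oracle

theorem EReducible.trans {A B C : Set ℕ} (h₁ : EReducible A B) (h₂ : EReducible B C) :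
    EReducible A C := by
  rw [eReducible_iff_enumerableFrom] at *
  exact h₁.subst h₂

theorem eEquiv_equivalence : Equivalence EEquiv :=
  ⟨fun A => ⟨.refl A, .refl A⟩, fun h => ⟨h.2, h.1⟩,
    fun h h' => ⟨h.1.trans h'.1, h'.2.trans h.2⟩⟩

theorem countable_setOf_eReducible (B : Set ℕ) : {A | EReducible A B}.Countable := by
  refine (Set.countable_range fun e => enumOp (ceSet e) B).mono fun A hA => ?_
  obtain ⟨e, rfl⟩ := eReducible_iff_exists_ceSet.1 hA
  exact ⟨e, rfl⟩

theorem enumOp_mono (Γ : Set ℕ) {A B : Set ℕ} (h : A ⊆ B) : enumOp Γ A ⊆ enumOp Γ B :=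
  fun _ ⟨u, hu, hA⟩ => ⟨u, hu, hA.trans h⟩

/-! ### Turing reducibility as enumeration reducibility of total sets -/

/-- The join `A ⊕ Aᶜ`: evens code membership in `A`, odds code non-membership. -/
def totalize (A : Set ℕ) : Set ℕ :=
  {m | (m % 2 = 0 ∧ m / 2 ∈ A) ∨ (m % 2 = 1 ∧ m / 2 ∉ A)}

theorem two_mul_mem_totalize {A : Set ℕ} {n : ℕ} : 2 * n ∈ totalize A ↔ n ∈ A := by
  simp [totalize]

theorem two_mul_add_one_mem_totalize {A : Set ℕ} {n : ℕ} : 2 * n + 1 ∈ totalize A ↔ n ∉ A := by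
  have h1 : (2 * n + 1) % 2 = 1 := by omega
  have h2 : (2 * n + 1) / 2 = n := by omega
  simp [totalize, h1, h2]

theorem totalize_injective : Function.Injective totalize := fun A B h => Set.ext fun n => by
  rw [← two_mul_mem_totalize, h, two_mul_mem_totalize]

theorem mem_charFun {A : Set ℕ} {n v : ℕ} :
    v ∈ charFun A n ↔ (v = 1 ∧ n ∈ A) ∨ (v = 0 ∧ n ∉ A) := by
  by_cases h : n ∈ A <;> simp [charFun, h]

/-- The primitive recursion scheme for partial functions, read off from a course of values. -/
theorem mem_natRec_iff {x : Part ℕ} {g : ℕ → ℕ → Part ℕ} {n v : ℕ} :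
    v ∈ (Nat.rec x (fun y IH => IH >>= g y) n : Part ℕ) ↔
      ∃ l : List ℕ, (l.getD 0 0 ∈ x ∧ l.getD n 0 = v) ∧
        ∀ k < n, l.getD (k + 1) 0 ∈ g k (l.getD k 0) := by
  constructor
  · intro h
    induction n generalizing v with
    | zero => exact ⟨[v], by simpa using h⟩
    | succ n ih =>
      obtain ⟨w, hw, hv⟩ := Part.mem_bind_iff.1 h
      obtain ⟨l, ⟨h0, hn⟩, hl⟩ := ih hw
      have key : ∀ k < n + 2, ((List.range (n + 2)).map fun k =>
          if k ≤ n then l.getD k 0 else v).getD k 0 = if k ≤ n then l.getD k 0 else v := by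
        intro k hk
        simp [List.getElem?_range hk]
      refine ⟨(List.range (n + 2)).map fun k => if k ≤ n then l.getD k 0 else v, ⟨?_, ?_⟩, ?_⟩
      · rw [key _ (by omega)]
        simpa using h0
      · rw [key _ (by omega)]
        simp
      · intro k hk
        rw [key _ (by omega), key _ (by omega), if_pos (show k ≤ n by omega)]
        rcases Nat.lt_succ_iff_lt_or_eq.1 hk with hk | rfl
        · rw [if_pos (by omega)]
          exact hl k hk
        · rw [if_neg (by omega), hn]
          exact hv
  · rintro ⟨l, ⟨h0, rfl⟩, hl⟩
    induction n with
    | zero => exact h0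
    | succ n ih =>
      exact Part.mem_bind_iff.2 ⟨_, ih fun k hk => hl k (by omega), hl n (by omega)⟩

/-- The functions whose graph is enumerable from `B ⊕ Bᶜ` contain the characteristic function of `B`
and are closed under all the operations that generate the functions recursive in `B`. -/
theorem enumerableFrom_graph_of_recursiveIn {B : Set ℕ} {f : ℕ →. ℕ}
    (h : Nat.RecursiveIn {charFun B} f) :
    EnumerableFrom (fun _ : Unit => totalize B) fun _ (p : ℕ × ℕ) => p.2 ∈ f p.1 := by
  open EnumerableFrom Primrec in
  induction h with
  | zero =>
    refine (of_primrecPred (Primrec.eq.comp snd (Primrec.const 0))).of_iff fun _ p => ?_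
    exact Part.mem_some_iff
  | succ =>
    refine (of_primrecPred (Primrec.eq.comp snd (Primrec.succ.comp fst))).of_iff fun _ p => ?_
    exact Part.mem_some_iff
  | left =>
    refine (of_primrecPred (Primrec.eq.comp snd
      (fst.comp (Primrec.unpair.comp fst)))).of_iff fun _ p => ?_
    exact Part.mem_some_iff
  | right =>
    refine (of_primrecPred (Primrec.eq.comp snd
      (snd.comp (Primrec.unpair.comp fst)))).of_iff fun _ p => ?_
    exact Part.mem_some_iff
  | oracle g hg =>
    rw [Set.mem_singleton_iff.1 hg]
    have hd : Primrec fun p : ℕ × ℕ => 2 * p.1 := nat_mul.comp (Primrec.const 2) fst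
    refine (((of_primrecPred (Primrec.eq.comp snd (Primrec.const 1))).and
      (mem_oracle.comp hd)).or
      ((of_primrecPred (Primrec.eq.comp snd (Primrec.const 0))).and
      (mem_oracle.comp (Primrec.succ.comp hd)))).of_iff fun _ p => ?_
    rw [mem_charFun, ← two_mul_add_one_mem_totalize, two_mul_mem_totalize]
  | @pair f h _ _ ihf ihh =>
    have hu : Primrec fun p : ℕ × ℕ => p.2.unpair := Primrec.unpair.comp snd
    refine ((ihf.comp (fst.pair (fst.comp hu))).and
      (ihh.comp (fst.pair (snd.comp hu)))).of_iff fun _ p => ?_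
    simp only [Seq.seq, Part.map_eq_map, Part.mem_bind_iff, Part.mem_map_iff]
    constructor
    · rintro ⟨_, ⟨a, ha, rfl⟩, b, hb, hp⟩
      rw [← hp]
      simpa using ⟨ha, hb⟩
    · rintro ⟨ha, hb⟩
      exact ⟨_, ⟨_, ha, rfl⟩, _, hb, by simp⟩
  | @comp f h _ _ ihf ihh =>
    have h1 := (ihh.comp (α := (ℕ × ℕ) × ℕ) ((fst.comp fst).pair snd)).and
      (ihf.comp (snd.pair (snd.comp fst)))
    refine h1.exists_nat.of_iff fun _ p => ?_
    exact Part.mem_bind_iff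
  | @prec f h _ _ ihf ihh =>
    have ha : Primrec fun x : (ℕ × ℕ) × List ℕ => x.1.1.unpair.1 :=
      fst.comp (Primrec.unpair.comp (fst.comp fst))
    have hn : Primrec fun x : (ℕ × ℕ) × List ℕ => x.1.1.unpair.2 :=
      snd.comp (Primrec.unpair.comp (fst.comp fst))
    have hget := Primrec.list_getD (0 : ℕ)
    have h1 := (ihf.comp (ha.pair (hget.comp snd (Primrec.const 0)))).and
      (of_primrecPred (Primrec.eq.comp (hget.comp snd hn) (snd.comp fst)))
    have hk : Primrec fun y : ((ℕ × ℕ) × List ℕ) × ℕ => y.2 := snd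
    have h2 := (ihh.comp ((Primrec₂.natPair.comp (ha.comp fst) (Primrec₂.natPair.comp hk
      (hget.comp (snd.comp fst) hk))).pair
      (hget.comp (snd.comp fst) (Primrec.succ.comp hk)))).forall_lt.comp
      (Primrec.id.pair hn)
    refine (h1.and h2).exists_denumerable.of_iff fun _ p => ?_
    exact mem_natRec_iff
  | @rfind f _ ihf =>
    have h1 := ihf.comp (α := ℕ × ℕ)
      ((Primrec₂.natPair.comp fst snd).pair (Primrec.const 0))
    have h2 := ((of_primrecPred (α := (ℕ × ℕ) × ℕ)
      (Primrec.eq.comp snd (Primrec.const 0)).not).and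
      (ihf.comp ((Primrec₂.natPair.comp (fst.comp fst) (snd.comp fst)).pair
        snd))).exists_nat.forall_lt
    refine (h1.and h2).of_iff fun _ p => ?_
    refine Nat.mem_rfind.trans (and_congr ?_ (forall₂_congr fun k _ => ?_))
    · simp
    · simp [and_comm]

section RecursiveIn

variable {O : Set (ℕ →. ℕ)}

theorem recursiveIn_of_primrec {f : ℕ → ℕ} (hf : Primrec f) : Nat.RecursiveIn O (f : ℕ →. ℕ) :=
  (Primrec.nat_iff.1 hf).recursiveIn

theorem recursiveIn_comp {f g : ℕ → ℕ} (hf : Nat.RecursiveIn O (f : ℕ →. ℕ))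
    (hg : Nat.RecursiveIn O (g : ℕ →. ℕ)) :
    Nat.RecursiveIn O ((fun n => f (g n) : ℕ → ℕ) : ℕ →. ℕ) :=
  (hf.comp hg).of_eq fun n => Part.bind_some (g n) _

theorem recursiveIn_pair {f g : ℕ → ℕ} (hf : Nat.RecursiveIn O (f : ℕ →. ℕ))
    (hg : Nat.RecursiveIn O (g : ℕ →. ℕ)) :
    Nat.RecursiveIn O ((fun n => Nat.pair (f n) (g n) : ℕ → ℕ) : ℕ →. ℕ) :=
  (hf.pair hg).of_eq fun n => by simp [Seq.seq]

end RecursiveIn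

open Classical in
/-- Inclusion of a finite set in the join of `B` with its complement is decided by querying `B`
at the halves of the members of the finite set. -/
theorem recursiveIn_canonicalFinite_subset_totalize (B : Set ℕ) :
    Nat.RecursiveIn {charFun B}
      ((fun u => if canonicalFinite u ⊆ totalize B then 1 else 0 : ℕ → ℕ) : ℕ →. ℕ) := by
  have hχ : Nat.RecursiveIn {charFun B} ((fun n => if n ∈ B then 1 else 0 : ℕ → ℕ) : ℕ →. ℕ) :=
    .oracle _ rfl
  -- An input `((u, (k, y)), b)` holds the verdict `y` on the members of `D_u` below `k` and the
  -- answer `b` of the oracle at `k / 2`. Since `k ∈ B ⊕ Bᶜ` iff that answer is `1` for even `k` and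
  -- `0` for odd `k`, the answer is compared with `(k + 1) % 2`.
  let good (p : ℕ) : Prop := p.unpair.1.unpair.2.unpair.2 = 1 ∧
    (¬ p.unpair.1.unpair.1.testBit p.unpair.1.unpair.2.unpair.1 = true ∨
      p.unpair.2 = (p.unpair.1.unpair.2.unpair.1 + 1) % 2)
  have hgood : PrimrecPred good := by
    have hl : Primrec fun p : ℕ => p.unpair.1 := Primrec.fst.comp Primrec.unpair
    have hr : Primrec fun p : ℕ => p.unpair.2 := Primrec.snd.comp Primrec.unpair
    have hk : Primrec fun p : ℕ => p.unpair.1.unpair.2.unpair.1 := hl.comp (hr.comp hl)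
    exact (Primrec.eq.comp (hr.comp (hr.comp hl)) (Primrec.const 1)).and
      ((primrecRel_testBit.comp (hl.comp hl) hk).not.or
        (Primrec.eq.comp hr (Primrec.nat_mod.comp (Primrec.succ.comp hk) (Primrec.const 2))))
  have hstep : Nat.RecursiveIn {charFun B} ((fun q => if good (Nat.pair q
      (if q.unpair.2.unpair.1 / 2 ∈ B then 1 else 0)) then 1 else 0 : ℕ → ℕ) : ℕ →. ℕ) := by
    refine recursiveIn_comp (f := fun p => if good p then 1 else 0)
      (recursiveIn_of_primrec (Primrec.ite hgood (Primrec.const 1) (Primrec.const 0)))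
      (recursiveIn_pair (recursiveIn_of_primrec Primrec.id) (recursiveIn_comp hχ
        (recursiveIn_of_primrec (f := fun q => q.unpair.2.unpair.1 / 2) ?_)))
    exact Primrec.nat_div.comp (Primrec.fst.comp (Primrec.unpair.comp
      (Primrec.snd.comp Primrec.unpair))) (Primrec.const 2)
  have hrec := (Nat.RecursiveIn.prec (recursiveIn_of_primrec (Primrec.const 1)) hstep).comp
    (recursiveIn_of_primrec (f := fun u => Nat.pair u u)
      (Primrec₂.natPair.comp Primrec.id Primrec.id))
  refine hrec.of_eq fun u => ?_
  have key : ∀ n, (Nat.rec (Part.some 1) (fun y IH => IH >>= fun i => Part.some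
      (if good (Nat.pair (Nat.pair u (Nat.pair y i)) (if y / 2 ∈ B then 1 else 0))
      then 1 else 0)) n : Part ℕ) = Part.some (if ∀ k < n, u.testBit k = true → k ∈ totalize B then 1 else 0) := by
    intro n
    induction n with
    | zero => simp
    | succ n ih =>
      simp only [ih]
      refine (Part.bind_some _ _).trans (congrArg Part.some ?_)
      refine if_congr ?_ rfl rfl
      rw [Nat.forall_lt_succ_right]
      simp only [good, Nat.unpair_pair]
      refine and_congr (by simp) ?_
      rw [imp_iff_not_or]
      refine or_congr Iff.rfl ?_
      rcases Nat.mod_two_eq_zero_or_one n with h | h <;> by_cases hB : n / 2 ∈ B <;>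
        simp [totalize, h, hB, Nat.add_mod]
  refine (Part.bind_some _ _).trans ?_
  simp only [Nat.unpair_pair]
  have h := key u
  have hiff : (∀ k < u, u.testBit k = true → k ∈ totalize B) ↔ canonicalFinite u ⊆ totalize B :=
    ⟨fun H k hk => H k (lt_of_mem_canonicalFinite hk) hk, fun H k _ hk => H hk⟩
  rw [if_congr hiff rfl rfl] at h
  simpa using h

theorem eReducible_totalize_of_recursiveIn {A B : Set ℕ}
    (h : Nat.RecursiveIn {charFun B} (charFun A)) : EReducible (totalize A) (totalize B) := by
  rw [eReducible_iff_enumerableFrom]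
  have hd : Primrec fun m : ℕ => m / 2 := Primrec.nat_div.comp .id (.const 2)
  have hm : Primrec fun m : ℕ => (m + 1) % 2 := Primrec.nat_mod.comp .succ (.const 2)
  refine ((enumerableFrom_graph_of_recursiveIn h).comp (hd.pair hm)).of_iff fun _ m => ?_
  rw [mem_charFun]
  rcases Nat.mod_two_eq_zero_or_one m with h | h <;> simp [totalize, h, Nat.add_mod]

/-- To compute the value at `n`, search for a value together with a certificate for it; that the
finite set in the certificate is included in `B ⊕ Bᶜ` is decidable in `B`. -/
theorem recursiveIn_of_eReducible_totalize {A B : Set ℕ}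
    (h : EReducible (totalize A) (totalize B)) : Nat.RecursiveIn {charFun B} (charFun A) := by
  classical
  rw [eReducible_iff_enumerableFrom] at h
  have hgraph : EnumerableFrom (fun _ : Unit => totalize B)
      fun _ (p : ℕ × ℕ) => p.2 ∈ charFun A p.1 :=
    (enumerableFrom_graph_of_recursiveIn (.oracle _ rfl)).subst h
  obtain ⟨R, hR, hgraph⟩ := hgraph
  have hgraph : ∀ p : ℕ × ℕ, p.2 ∈ charFun A p.1 ↔
      ∃ s u, R (p, s, u) ∧ canonicalFinite u ⊆ totalize B := hgraph ()
  -- An input `(n, (v, (s, u)))` passes the first test if `(s, u)` certifies that `v` is the value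
  -- at `n`.
  let test (p : ℕ) : Prop := R ((p.unpair.1, p.unpair.2.unpair.1),
    p.unpair.2.unpair.2.unpair.1, p.unpair.2.unpair.2.unpair.2)
  have hl : Primrec fun p : ℕ => p.unpair.1 := Primrec.fst.comp Primrec.unpair
  have hr : Primrec fun p : ℕ => p.unpair.2 := Primrec.snd.comp Primrec.unpair
  have htest : PrimrecPred test := hR.comp ((hl.pair (hl.comp hr)).pair
    ((hl.comp (hr.comp hr)).pair (hr.comp (hr.comp hr))))
  let verdict (p : ℕ) : ℕ :=
    if test p ∧ canonicalFinite p.unpair.2.unpair.2.unpair.2 ⊆ totalize B then 0 else 1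
  have hcond : Nat.RecursiveIn {charFun B} (verdict : ℕ →. ℕ) := by
    refine (recursiveIn_comp (f := fun q => if test q.unpair.1 ∧ q.unpair.2 = 1 then 0 else 1)
      (recursiveIn_of_primrec (Primrec.ite ((htest.comp hl).and
        (Primrec.eq.comp hr (Primrec.const 1))) (Primrec.const 0) (Primrec.const 1)))
      (recursiveIn_pair (recursiveIn_of_primrec Primrec.id)
        (recursiveIn_comp (recursiveIn_canonicalFinite_subset_totalize B)
          (recursiveIn_of_primrec (hr.comp (hr.comp hr)))))).of_eq fun p => ?_
    simp [verdict]
  refine ((recursiveIn_of_primrec hl).comp hcond.rfind).of_eq fun n => ?_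
  have hpass : ∀ m, true ∈ (fun m => decide (m = 0)) <$> Part.some (verdict (Nat.pair n m)) ↔
      R ((n, m.unpair.1), m.unpair.2.unpair.1, m.unpair.2.unpair.2) ∧
        canonicalFinite m.unpair.2.unpair.2 ⊆ totalize B := by
    intro m
    simp [test, verdict]
  obtain ⟨v, hv⟩ : ∃ v, charFun A n = Part.some v := ⟨_, rfl⟩
  rw [hv, Part.eq_some_iff]
  refine Part.mem_bind_iff.2 ?_
  obtain ⟨s, u, h1, h2⟩ := (hgraph (n, v)).1 (by simp [hv])
  have hdom : (Nat.rfind fun m =>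
      (fun m => decide (m = 0)) <$> Part.some (verdict (Nat.pair n m))).Dom :=
    Nat.rfind_dom.2 ⟨Nat.pair v (Nat.pair s u), (hpass _).2 (by simpa using ⟨h1, h2⟩),
      fun _ => trivial⟩
  refine ⟨_, Part.get_mem hdom, ?_⟩
  have hspec := (hpass _).1 (Nat.rfind_spec (Part.get_mem hdom))
  have := (hgraph (n, _)).2 ⟨_, _, hspec⟩
  rw [hv] at this
  exact Part.mem_some_iff.2 (Part.mem_some_iff.1 this).symm

theorem tReducible_iff_eReducible_totalize {A B : Set ℕ} :
    TReducible A B ↔ EReducible (totalize A) (totalize B) :=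
  RecursiveIn.iff_nat.trans
    ⟨eReducible_totalize_of_recursiveIn, recursiveIn_of_eReducible_totalize⟩

/-! ### Total and nontotal enumeration degrees -/

/-- The enumeration degree of `X` is total: it contains a set of the form `Y ⊕ Yᶜ`. -/
def HasTotalDegree (X : Set ℕ) : Prop := ∃ Y, EEquiv X (totalize Y)

theorem EEquiv.hasTotalDegree_iff {X Y : Set ℕ} (h : EEquiv X Y) :
    HasTotalDegree X ↔ HasTotalDegree Y :=
  ⟨fun ⟨Z, hZ⟩ => ⟨Z, eEquiv_equivalence.trans (eEquiv_equivalence.symm h) hZ⟩,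
    fun ⟨Z, hZ⟩ => ⟨Z, eEquiv_equivalence.trans h hZ⟩⟩

theorem exists_totalize_eq_iff {Z : Set ℕ} :
    (∃ Y, totalize Y = Z) ↔ ∀ n, 2 * n + 1 ∈ Z ↔ 2 * n ∉ Z := by
  constructor
  · rintro ⟨Y, rfl⟩ n
    rw [two_mul_mem_totalize, two_mul_add_one_mem_totalize]
  · intro h
    refine ⟨{n | 2 * n ∈ Z}, Set.ext fun m => ?_⟩
    obtain ⟨n, rfl | rfl⟩ := Nat.even_or_odd' m
    · exact two_mul_mem_totalize
    · exact two_mul_add_one_mem_totalize.trans (h n).symm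

theorem hasTotalDegree_iff {X : Set ℕ} :
    HasTotalDegree X ↔ ∃ i j, (∀ n, 2 * n + 1 ∈ enumOp (ceSet i) X ↔ 2 * n ∉ enumOp (ceSet i) X) ∧
      ∀ n, n ∈ X ↔ n ∈ enumOp (ceSet j) (enumOp (ceSet i) X) := by
  simp only [← exists_totalize_eq_iff, ← Set.ext_iff]
  constructor
  · rintro ⟨Y, hXY, hYX⟩
    obtain ⟨i, hi⟩ := eReducible_iff_exists_ceSet.1 hYX
    obtain ⟨j, hj⟩ := eReducible_iff_exists_ceSet.1 hXY
    exact ⟨i, j, ⟨Y, hi⟩, hi ▸ hj⟩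
  · rintro ⟨i, j, ⟨Y, hY⟩, hX⟩
    rw [← hY] at hX
    exact ⟨Y, eReducible_iff_exists_ceSet.2 ⟨j, hX⟩, eReducible_iff_exists_ceSet.2 ⟨i, hY⟩⟩

theorem eq_of_totalize_subset {Y Z : Set ℕ} (h : totalize Y ⊆ totalize Z) : Y = Z := by
  refine Set.Subset.antisymm (fun n hn => two_mul_mem_totalize.1 (h (two_mul_mem_totalize.2 hn)))
    fun n hn => ?_
  by_contra hY
  exact two_mul_add_one_mem_totalize.1 (h (two_mul_add_one_mem_totalize.2 hY)) hn

/-- The join of `C` with the lower Dedekind cut of `r`, along an enumeration of the rationals. -/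
def joinCut (C : Set ℕ) (r : ℝ) : Set ℕ :=
  {m | (m % 2 = 0 ∧ m / 2 ∈ C) ∨ (m % 2 = 1 ∧ (Denumerable.ofNat ℚ (m / 2) : ℝ) < r)}

theorem joinCut_mono (C : Set ℕ) : Monotone (joinCut C) := fun _ _ h _ =>
  Or.imp_right fun hm => ⟨hm.1, hm.2.trans_le h⟩

theorem joinCut_injective (C : Set ℕ) : Function.Injective (joinCut C) := by
  have key : ∀ r s, r < s → joinCut C r ≠ joinCut C s := by
    intro r s hrs h
    obtain ⟨q, hq⟩ := exists_rat_btwn hrs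
    obtain ⟨k, rfl⟩ : ∃ k, Denumerable.ofNat ℚ k = q := ⟨_, Denumerable.ofNat_encode q⟩
    have hk : (2 * k + 1) / 2 = k := by omega
    have h' := congrArg (2 * k + 1 ∈ ·) h
    simp only [joinCut, Set.mem_ofPred_eq, hk, Nat.mul_add_mod,
      Nat.one_mod, eq_iff_iff] at h'
    simp only [one_ne_zero, false_and, true_and, false_or] at h'
    exact absurd (h'.2 hq.2) hq.1.not_gt
  intro r s h
  rcases lt_trichotomy r s with hrs | rfl | hrs
  · exact absurd h (key r s hrs)
  · rfl
  · exact absurd h.symm (key s r hrs)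

theorem eReducible_joinCut (C : Set ℕ) (r : ℝ) : EReducible C (joinCut C r) := by
  rw [eReducible_iff_enumerableFrom]
  refine ((EnumerableFrom.mem_oracle (ι := Unit) (O := fun _ => joinCut C r)).comp
    (f := fun n => 2 * n) (Primrec.nat_mul.comp (.const 2) .id)).of_iff fun _ n => ?_
  simp [joinCut]

/-- Nontotal degrees are cofinal. For fixed indices `i`, `j`, the sets `X` for which `Γ_i(X)` is of
the form `Y ⊕ Yᶜ` and `X = Γ_j(Γ_i(X))` are pairwise incomparable under inclusion, because `Γ_i` is
monotone and distinct sets of the form `Y ⊕ Yᶜ` are incomparable. So at most countably many members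
of an uncountable chain of sets above `C` have total degree. -/
theorem exists_eReducible_not_hasTotalDegree (C : Set ℕ) :
    ∃ X, EReducible C X ∧ ¬ HasTotalDegree X := by
  by_contra! H
  have H' : ∀ r : ℝ, ∃ p : ℕ × ℕ, (∃ Y, totalize Y = enumOp (ceSet p.1) (joinCut C r)) ∧
      joinCut C r = enumOp (ceSet p.2) (enumOp (ceSet p.1) (joinCut C r)) := by
    intro r
    obtain ⟨i, j, h1, h2⟩ := hasTotalDegree_iff.1 (H _ (eReducible_joinCut C r))
    exact ⟨(i, j), exists_totalize_eq_iff.2 h1, Set.ext h2⟩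
  choose p hp using H'
  have key : ∀ r s, r ≤ s → p r = p s → r = s := by
    intro r s hrs hps
    obtain ⟨⟨Y, hY⟩, hr⟩ := hp r
    obtain ⟨⟨Z, hZ⟩, hs⟩ := hp s
    have hYZ : totalize Y ⊆ totalize Z := by
      rw [hY, hZ, hps]
      exact enumOp_mono _ (joinCut_mono C hrs)
    apply joinCut_injective C
    rw [hr, hs, ← hY, ← hZ, eq_of_totalize_subset hYZ, hps]
  have hinj : Function.Injective p := fun r s h =>
    (le_total r s).elim (fun hrs => key r s hrs h) fun hsr => (key s r hsr h.symm).symm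
  exact not_countable (α := ℝ) hinj.countable

instance uncountable_setNat : Uncountable (Set ℕ) :=
  (joinCut_injective ∅).uncountable

theorem exists_not_eReducible (B : Set ℕ) : ∃ D, ¬ EReducible D B := by
  by_contra! H
  exact not_countable (α := Set ℕ) (Set.countable_univ_iff.1
    ((countable_setOf_eReducible B).mono fun D _ => H D))

theorem eReducible_totalize_self (C : Set ℕ) : EReducible C (totalize C) := by
  rw [eReducible_iff_enumerableFrom]
  refine ((EnumerableFrom.mem_oracle (ι := Unit) (O := fun _ => totalize C)).comp
    (f := fun n => 2 * n) (Primrec.nat_mul.comp (.const 2) .id)).of_iff fun _ n => ?_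
  exact two_mul_mem_totalize.symm

theorem hasTotalDegree_totalize (Y : Set ℕ) : HasTotalDegree (totalize Y) :=
  ⟨Y, eEquiv_equivalence.refl _⟩

theorem exists_hasTotalDegree_not_eReducible (C : Set ℕ) :
    ∃ X Y, EReducible C X ∧ EReducible C Y ∧ HasTotalDegree X ∧ HasTotalDegree Y ∧
      ¬ EReducible Y X := by
  obtain ⟨D, hD⟩ := exists_not_eReducible (totalize C)
  let E : Set ℕ := {m | (m % 2 = 0 ∧ m / 2 ∈ C) ∨ (m % 2 = 1 ∧ m / 2 ∈ D)}
  have hd : Primrec fun n : ℕ => 2 * n := Primrec.nat_mul.comp (.const 2) .id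
  have hC : EReducible C E := by
    rw [eReducible_iff_enumerableFrom]
    refine ((EnumerableFrom.mem_oracle (ι := Unit) (O := fun _ => E)).comp hd).of_iff
      fun _ n => ?_
    simp [E]
  have hDE : EReducible D E := by
    rw [eReducible_iff_enumerableFrom]
    refine ((EnumerableFrom.mem_oracle (ι := Unit) (O := fun _ => E)).comp
      (Primrec.succ.comp hd)).of_iff fun _ n => ?_
    have h1 : (2 * n + 1) / 2 = n := by omega
    simp [E, h1]
  exact ⟨totalize C, totalize E, eReducible_totalize_self C, hC.trans (eReducible_totalize_self E),
    hasTotalDegree_totalize C, hasTotalDegree_totalize E,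
    fun h => hD ((hDE.trans (eReducible_totalize_self E)).trans h)⟩

/-! ### Functions that are constant exactly on the nontotal degrees -/

/-- The function that is `A` on sets of nontotal degree and `X` on sets `X` of total degree. The
values are coded by residues modulo `3`: elements of `A` by residue `2`, elements of `X` by residue
`1`, and residue `0` flags that `X` has total degree, so that an enumeration operator can tell the
two cases apart. -/
def constOnNontotal (A X : Set ℕ) : Set ℕ :=
  {m | (HasTotalDegree X ∧ (m % 3 = 0 ∨ (m % 3 = 1 ∧ m / 3 ∈ X))) ∨
    (¬ HasTotalDegree X ∧ m % 3 = 2 ∧ m / 3 ∈ A)}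

section constOnNontotal

variable {A B X : Set ℕ}

theorem mem_constOnNontotal_of_hasTotalDegree (hX : HasTotalDegree X) {m : ℕ} :
    m ∈ constOnNontotal A X ↔ m % 3 = 0 ∨ (m % 3 = 1 ∧ m / 3 ∈ X) := by
  simp [constOnNontotal, hX]

theorem mem_constOnNontotal_of_not_hasTotalDegree (hX : ¬ HasTotalDegree X) {m : ℕ} :
    m ∈ constOnNontotal A X ↔ m % 3 = 2 ∧ m / 3 ∈ A := by
  simp [constOnNontotal, hX]

theorem primrec_div_three : Primrec fun m : ℕ => m / 3 :=
  Primrec.nat_div.comp .id (.const 3)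

theorem primrecPred_mod_three (r : ℕ) : PrimrecPred fun m : ℕ => m % 3 = r :=
  Primrec.eq.comp (Primrec.nat_mod.comp .id (.const 3)) (.const r)

theorem primrec_three_mul_add (r : ℕ) : Primrec fun m : ℕ => 3 * m + r :=
  Primrec.nat_add.comp (Primrec.nat_mul.comp (.const 3) .id) (.const r)

theorem eEquiv_constOnNontotal_of_hasTotalDegree (A : Set ℕ) (hX : HasTotalDegree X) :
    EEquiv (constOnNontotal A X) X := by
  constructor <;> rw [eReducible_iff_enumerableFrom]
  · exact ((EnumerableFrom.of_primrecPred (primrecPred_mod_three 0)).or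
      ((EnumerableFrom.of_primrecPred (primrecPred_mod_three 1)).and
        (EnumerableFrom.mem_oracle.comp primrec_div_three))).of_iff
      fun _ _ => mem_constOnNontotal_of_hasTotalDegree hX
  · refine (EnumerableFrom.mem_oracle.comp (primrec_three_mul_add 1)).of_iff fun _ m => ?_
    have h1 : (3 * m + 1) / 3 = m := by omega
    simp [mem_constOnNontotal_of_hasTotalDegree hX, h1, Nat.add_mod]

theorem eEquiv_constOnNontotal_of_not_hasTotalDegree (A : Set ℕ) (hX : ¬ HasTotalDegree X) :
    EEquiv (constOnNontotal A X) A := by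
  constructor <;> rw [eReducible_iff_enumerableFrom]
  · exact ((EnumerableFrom.of_primrecPred (primrecPred_mod_three 2)).and
        (EnumerableFrom.mem_oracle.comp primrec_div_three)).of_iff
      fun _ _ => mem_constOnNontotal_of_not_hasTotalDegree hX
  · refine (EnumerableFrom.mem_oracle.comp (primrec_three_mul_add 2)).of_iff fun _ m => ?_
    have h1 : (3 * m + 2) / 3 = m := by omega
    simp [mem_constOnNontotal_of_not_hasTotalDegree hX, h1, Nat.add_mod]

theorem lEOnCone_constOnNontotal_iff :
    LEOnCone (constOnNontotal A) (constOnNontotal B) ↔ EReducible A B := by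
  constructor
  · rintro ⟨C, hC⟩
    obtain ⟨X, hCX, hX⟩ := exists_eReducible_not_hasTotalDegree C
    exact ((eEquiv_constOnNontotal_of_not_hasTotalDegree A hX).2.trans (hC X hCX)).trans
      (eEquiv_constOnNontotal_of_not_hasTotalDegree B hX).1
  · refine fun h => ⟨∅, fun X _ => ?_⟩
    by_cases hX : HasTotalDegree X
    · exact (eEquiv_constOnNontotal_of_hasTotalDegree A hX).1.trans
        (eEquiv_constOnNontotal_of_hasTotalDegree B hX).2
    · exact ((eEquiv_constOnNontotal_of_not_hasTotalDegree A hX).1.trans h).trans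
        (eEquiv_constOnNontotal_of_not_hasTotalDegree B hX).2

theorem lEOnCone_constOnNontotal_id (A : Set ℕ) : LEOnCone (constOnNontotal A) id := by
  refine ⟨A, fun X hAX => ?_⟩
  by_cases hX : HasTotalDegree X
  · exact (eEquiv_constOnNontotal_of_hasTotalDegree A hX).1
  · exact (eEquiv_constOnNontotal_of_not_hasTotalDegree A hX).1.trans hAX

theorem constOnNontotal_injective : Function.Injective constOnNontotal := by
  intro A B h
  obtain ⟨X, -, hX⟩ := exists_eReducible_not_hasTotalDegree ∅
  ext n
  have h1 : (3 * n + 2) / 3 = n := by omega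
  have h2 := congrArg (3 * n + 2 ∈ ·) (congrFun h X)
  simpa [mem_constOnNontotal_of_not_hasTotalDegree hX, h1, Nat.add_mod] using h2

theorem not_constantOnCone_constOnNontotal (A : Set ℕ) :
    ¬ ConstantOnCone (constOnNontotal A) := by
  rintro ⟨C, hC⟩
  obtain ⟨X, Y, hX, hY, hX', hY', hXY⟩ := exists_hasTotalDegree_not_eReducible C
  exact hXY (((eEquiv_constOnNontotal_of_hasTotalDegree A hY').2.trans (hC Y X hY hX).1).trans
    (eEquiv_constOnNontotal_of_hasTotalDegree A hX').1)

theorem eInvariant_constOnNontotal (A : Set ℕ) : EInvariant (constOnNontotal A) := by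
  intro X Y h
  by_cases hX : HasTotalDegree X
  · exact eEquiv_equivalence.trans (eEquiv_constOnNontotal_of_hasTotalDegree A hX)
      (eEquiv_equivalence.trans h (eEquiv_equivalence.symm
        (eEquiv_constOnNontotal_of_hasTotalDegree A (h.hasTotalDegree_iff.1 hX))))
  · exact eEquiv_equivalence.trans (eEquiv_constOnNontotal_of_not_hasTotalDegree A hX)
      (eEquiv_equivalence.symm
        (eEquiv_constOnNontotal_of_not_hasTotalDegree A (h.hasTotalDegree_iff.not.1 hX)))

/-- One enumeration operator transforms the values at `Y` into those at `Γ_e(Y)`, for all `Y` whose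
degree is total exactly when that of `Γ_e(Y)` is: it copies residues `0` and `2`, and applies `Γ_e`
to the elements of residue `1` once it has seen the flag. -/
theorem exists_enumOp_constOnNontotal (A : Set ℕ) (e : ℕ) :
    ∃ e', ∀ Y, (HasTotalDegree (enumOp (ceSet e) Y) ↔ HasTotalDegree Y) →
      constOnNontotal A (enumOp (ceSet e) Y) = enumOp (ceSet e') (constOnNontotal A Y) := by
  let O : {Y // HasTotalDegree (enumOp (ceSet e) Y) ↔ HasTotalDegree Y} → Set ℕ :=
    fun Y => constOnNontotal A Y
  have hpre : EnumerableFrom O fun Y n => n ∈ {k | 3 * k + 1 ∈ O Y} :=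
    EnumerableFrom.mem_oracle.comp (primrec_three_mul_add 1)
  have hΓ := ((enumerableFrom_enumOp_ceSet (fun Y => {k | 3 * k + 1 ∈ O Y}) e).subst hpre).comp
    primrec_div_three
  have hflag : EnumerableFrom O fun Y (_ : ℕ) => 0 ∈ O Y :=
    EnumerableFrom.mem_oracle.comp (.const 0)
  have h : EnumerableFrom O fun Y m => m ∈ constOnNontotal A (enumOp (ceSet e) Y) := by
    refine (((EnumerableFrom.of_primrecPred (primrecPred_mod_three 1).not).and
      EnumerableFrom.mem_oracle).or (((EnumerableFrom.of_primrecPred (primrecPred_mod_three 1)).and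
        hflag).and hΓ)).of_iff ?_
    rintro ⟨Y, hY⟩ m
    by_cases hT : HasTotalDegree Y
    · have hpreY : {k | 3 * k + 1 ∈ constOnNontotal A Y} = Y := by
        ext k
        have h1 : (3 * k + 1) / 3 = k := by omega
        simp [mem_constOnNontotal_of_hasTotalDegree hT, h1, Nat.add_mod]
      simp only [O, hpreY]
      simp only [mem_constOnNontotal_of_hasTotalDegree hT,
        mem_constOnNontotal_of_hasTotalDegree (hY.2 hT)]
      grind
    · simp only [O, mem_constOnNontotal_of_not_hasTotalDegree hT,
        mem_constOnNontotal_of_not_hasTotalDegree (hY.not.2 hT)]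
      grind
  obtain ⟨e', he'⟩ := h.exists_ceSet
  exact ⟨e', fun Y hY => he' ⟨Y, hY⟩⟩

theorem uniformlyEInvariant_constOnNontotal (A : Set ℕ) :
    UniformlyEInvariant (constOnNontotal A) := by
  choose v hv using exists_enumOp_constOnNontotal A
  refine ⟨eInvariant_constOnNontotal A, fun p => Nat.pair (v p.unpair.1) (v p.unpair.2), ?_⟩
  rintro p X Y ⟨hX, hY⟩
  have h : HasTotalDegree X ↔ HasTotalDegree Y := EEquiv.hasTotalDegree_iff
    ⟨eReducible_iff_exists_ceSet.2 ⟨_, hX⟩, eReducible_iff_exists_ceSet.2 ⟨_, hY⟩⟩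
  refine ⟨?_, ?_⟩ <;> rw [Nat.unpair_pair]
  · rw [← hv _ Y (by rwa [← hX]), ← hX]
  · rw [← hv _ X (by rw [← hY, h]), ← hY]

end constOnNontotal

/-! ### Measurability -/

theorem measurable_enumOp (Γ : Set ℕ) : Measurable (enumOp Γ) := by
  refine measurable_set_iff.2 fun n => ?_
  change Measurable fun X : Set ℕ => ∃ u, Nat.pair n u ∈ Γ ∧ ∀ k, k ∈ canonicalFinite u → k ∈ X
  exact Measurable.exists fun u => measurable_const.and (Measurable.forall fun k =>
    measurable_const.imp (measurable_set_mem k))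

theorem measurable_hasTotalDegree : Measurable HasTotalDegree := by
  have h : HasTotalDegree = fun X => ∃ i j,
      (∀ n, 2 * n + 1 ∈ enumOp (ceSet i) X ↔ 2 * n ∉ enumOp (ceSet i) X) ∧
      ∀ n, n ∈ X ↔ n ∈ enumOp (ceSet j) (enumOp (ceSet i) X) :=
    funext fun X => propext hasTotalDegree_iff
  rw [h]
  refine Measurable.exists fun i => Measurable.exists fun j => ?_
  have hi := measurable_set_iff.1 (measurable_enumOp (ceSet i))
  have hj := measurable_set_iff.1
    ((measurable_enumOp (ceSet j)).comp (measurable_enumOp (ceSet i)))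
  exact (Measurable.forall fun n => (hi _).iff (hi _).not).and
    (Measurable.forall fun n => (measurable_set_mem n).iff (hj n))

theorem measurable_constOnNontotal (A : Set ℕ) : Measurable (constOnNontotal A) := by
  refine measurable_set_iff.2 fun m => ?_
  change Measurable fun X => (HasTotalDegree X ∧ (m % 3 = 0 ∨ (m % 3 = 1 ∧ m / 3 ∈ X))) ∨
    (¬ HasTotalDegree X ∧ m % 3 = 2 ∧ m / 3 ∈ A)
  exact (measurable_hasTotalDegree.and (measurable_const.or
    (measurable_const.and (measurable_set_mem _)))).or
    (measurable_hasTotalDegree.not.and measurable_const)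

/-! ### Borel uniformly invariant nonconstant functions -/

theorem borelUniformNonconstant_constOnNontotal (A : Set ℕ) :
    BorelUniformNonconstant (constOnNontotal A) :=
  ⟨measurable_constOnNontotal A, uniformlyEInvariant_constOnNontotal A,
    not_constantOnCone_constOnNontotal A⟩

theorem BorelUniformNonconstant.borelInvariantNonconstant {f : Set ℕ → Set ℕ}
    (hf : BorelUniformNonconstant f) : BorelInvariantNonconstant f :=
  ⟨hf.1, hf.2.1.1, hf.2.2⟩

theorem borelUniformNonconstant_id : BorelUniformNonconstant id := by
  refine ⟨measurable_id, ⟨fun _ _ h => h, id, fun _ _ _ h => h⟩, ?_⟩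
  rintro ⟨C, hC⟩
  obtain ⟨X, Y, hX, hY, -, -, hXY⟩ := exists_hasTotalDegree_not_eReducible C
  exact hXY (hC Y X hY hX).1

theorem exists_uncountable_pairwise_not_eEquiv :
    ∃ S : Set (Set ℕ), ¬ S.Countable ∧ S.Pairwise fun A B => ¬ EEquiv A B := by
  let s : Setoid (Set ℕ) := ⟨EEquiv, eEquiv_equivalence⟩
  refine ⟨Set.range (Quotient.out : Quotient s → Set ℕ), fun h => ?_, ?_⟩
  · have hU : (⋃ A ∈ Set.range (Quotient.out : Quotient s → Set ℕ),
        {B | EReducible B A}).Countable :=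
      h.biUnion fun A _ => countable_setOf_eReducible A
    refine not_countable (α := Set ℕ) (Set.countable_univ_iff.1 (hU.mono fun B _ => ?_))
    have hB : EEquiv (Quotient.out (Quotient.mk s B)) B := Quotient.mk_out B
    exact Set.mem_biUnion ⟨_, rfl⟩ hB.2
  · rintro _ ⟨a, rfl⟩ _ ⟨b, rfl⟩ hab h
    exact hab (congrArg _ (Quotient.out_equiv_out.1 h))

end EnumDeg

theorem corollary3p4 :
    (∃ F : Set ℕ → (Set ℕ → Set ℕ), Function.Injective F ∧
      (∀ A : Set ℕ, EnumDeg.BorelInvariantNonconstant (F A)) ∧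
      ∀ A B : Set ℕ, EnumDeg.EReducible A B ↔ EnumDeg.LEOnCone (F A) (F B)) ∧
    (∃ F : Set ℕ → (Set ℕ → Set ℕ), Function.Injective F ∧
      (∀ A : Set ℕ, EnumDeg.BorelInvariantNonconstant (F A)) ∧
      ∀ A B : Set ℕ, EnumDeg.TReducible A B ↔ EnumDeg.LEOnCone (F A) (F B)) ∧
    (∃ f : Set ℕ → Set ℕ, EnumDeg.BorelUniformNonconstant f ∧
      ∃ 𝒢 : Set (Set ℕ → Set ℕ), ¬ 𝒢.Countable ∧
        (∀ g ∈ 𝒢, EnumDeg.BorelUniformNonconstant g ∧ EnumDeg.LEOnCone g f) ∧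
        𝒢.Pairwise fun g h => ¬ (EnumDeg.LEOnCone g h ∧ EnumDeg.LEOnCone h g)) := by
  open EnumDeg in
  refine ⟨⟨constOnNontotal, constOnNontotal_injective,
    fun A => (borelUniformNonconstant_constOnNontotal A).borelInvariantNonconstant,
    fun A B => lEOnCone_constOnNontotal_iff.symm⟩,
    ⟨fun A => constOnNontotal (totalize A), constOnNontotal_injective.comp totalize_injective,
      fun A => (borelUniformNonconstant_constOnNontotal _).borelInvariantNonconstant,
      fun A B => tReducible_iff_eReducible_totalize.trans lEOnCone_constOnNontotal_iff.symm⟩,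
    id, borelUniformNonconstant_id, ?_⟩
  obtain ⟨S, hS, hpair⟩ := exists_uncountable_pairwise_not_eEquiv
  refine ⟨constOnNontotal '' S,
    fun h => hS (Set.countable_of_injective_of_countable_image constOnNontotal_injective.injOn h),
    ?_, ?_⟩
  · rintro _ ⟨A, -, rfl⟩
    exact ⟨borelUniformNonconstant_constOnNontotal A, lEOnCone_constOnNontotal_id A⟩
  · rintro _ ⟨A, hA, rfl⟩ _ ⟨B, hB, rfl⟩ hAB h
    exact hpair hA hB (fun h' => hAB (h' ▸ rfl))
      (h.imp lEOnCone_constOnNontotal_iff.1 lEOnCone_constOnNontotal_iff.1)
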